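/- Let $\mathbb{T}=\{z\in\mathbb{C}:|z|=1\}$; by a measure on $\mathbb{T}$ we mean a finite positive Borel measure, and it is called continuous if it has no atoms. For measures $\nu_1,\dots,\nu_n$ on $\mathbb{T}$ let $\nu_1\ast\cdots\ast\nu_n$ be the image of $\nu_1\otimes\cdots\otimes\nu_n$ under $(z_1,\dots,z_n)\mapsto z_1\cdots z_n$, and let $\sigma^{\ast k}=\sigma\ast\cdots\ast\sigma$ ($k$ factors). A measure $\mu$ on $\mathbb{T}$ has the CS($n$) property if $\mu\perp\nu_1\ast\cdots\ast\nu_n$ for all continuous measures $\nu_1,\dots,\nu_n$ on $\mathbb{T}$. For a unitary operator $U$ on a Hilbert space $H$, let $U^{\odot n}$ be the restriction of $U^{\otimes n}$ to the closed subspace $H^{\odot n}\subset H^{\otimes n}$ of tensors that are invariant under all permutations $x_1\otimes\cdots\otimes x_n\mapsto x_{\pi(1)}\otimes\cdots\otimes x_{\pi(n)}$, where $H^{\otimes n}$ is the Hilbert space tensor power. For $x\in H$ let $\mathbb{Z}(x)$ be the closed linear span of $\{U^jx:j\in\mathbb{Z}\}$, and let the spectral measure $\sigma_x$ be the measure on $\mathbb{T}$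 with $\langle U^jx,x\rangle=\int_{\mathbb{T}}z^j\,d\sigma_x(z)$ for all $j\in\mathbb{Z}$. The operator $U$ has simple spectrum if there is an orthogonal decomposition $H=\bigoplus_{i\ge 1}\mathbb{Z}(x_i)$ with $\sigma_{x_1}\gg\sigma_{x_2}\gg\cdots$ whose multiplicity function $z\mapsto\#\{i\ge1:\frac{d\sigma_{x_i}}{d\sigma_{x_1}}(z)\ne0\}$ equals $1$ $\sigma_{x_1}$-almost everywhere. Let $\sigma$ be a continuous measure on $\mathbb{T}$, let $V_\sigma$ be the unitary operator $(V_\sigma f)(z)=zf(z)$ on $L^2(\mathbb{T},\sigma)$, and let $m,k\ge 1$ be integers such that $V_\sigma^{\odot mk}$ has simple spectrum. Then $\sigma^{\ast k}$ has the CS($n$) property for every natural number $n$ such that $$(m!)^n>\frac{(mk)!}{(k!)^m}.$$ -/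

import Mathlib

noncomputable section

open MeasureTheory
open scoped ComplexConjugate ComplexOrder TensorProduct

/-! ### Measures on the circle -/

/-- The circle group `𝕋 = {z ∈ ℂ : |z| = 1}` carries its Borel σ-algebra. -/
instance Circle.instMeasurableSpaceBorel : MeasurableSpace Circle := borel Circle

instance Circle.instBorelSpaceBorel : BorelSpace Circle := ⟨rfl⟩

namespace ConvSing

/-- The convolution `ν₁ ∗ ⋯ ∗ νₙ` of finite measures on the circle: the image of
`ν₁ ⊗ ⋯ ⊗ νₙ` under `(z₁, …, zₙ) ↦ z₁ ⋯ zₙ`. -/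
def conv {n : ℕ} (ν : Fin n → Measure Circle) : Measure Circle :=
  (Measure.pi ν).map fun z => ∏ i, z i

/-- The convolution power `σ ∗ ⋯ ∗ σ` (`k` factors). -/
def convPow (σ : Measure Circle) (k : ℕ) : Measure Circle :=
  conv fun _ : Fin k => σ

/-- Convolution singularity of order `n`: `σ` is singular to the convolution of any `n`
continuous (that is, atomless) finite measures on the circle. -/
def CS (n : ℕ) (σ : Measure Circle) : Prop :=
  ∀ ν : Fin n → Measure Circle, (∀ i, IsFiniteMeasure (ν i)) → (∀ i, NullSingletonClass (ν i)) →
    Measure.MutuallySingular σ (conv ν)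

/-! ### Spectral theory of a unitary operator -/

section Spectral

variable {H : Type*} [NormedAddCommGroup H] [InnerProductSpace ℂ H]

/-- The cyclic space generated by `x`: the closed linear span of the `Uⁿ x`, `n ∈ ℤ`. -/
def cyclicSpace (U : H ≃ₗᵢ[ℂ] H) (x : H) : Submodule ℂ H :=
  (Submodule.span ℂ (Set.range fun n : ℤ => (U ^ n) x)).topologicalClosure

/-- `μ` is the spectral measure of `x`: the finite measure with `⟨Uⁿ x, x⟩ = ∫ zⁿ dμ(z)` for all
`n ∈ ℤ`. (Mathlib's inner product is linear in the second variable.) -/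
structure IsSpectralMeasure (U : H ≃ₗᵢ[ℂ] H) (x : H) (μ : Measure Circle) : Prop where
  finite : IsFiniteMeasure μ
  fourier : ∀ n : ℤ, inner ℂ x ((U ^ n) x) = ∫ z : Circle, (z : ℂ) ^ n ∂μ

/-- A spectral decomposition `H = ⨁ₙ ℤ(xₙ)` (orthogonal Hilbert sum of cyclic spaces) with
`σ_{x₀} ≫ σ_{x₁} ≫ ⋯`, where `μ n` is the spectral measure of `x n`. -/
structure IsSpectralDecomposition (U : H ≃ₗᵢ[ℂ] H) (x : ℕ → H) (μ : ℕ → Measure Circle) :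
    Prop where
  spectral : ∀ n, IsSpectralMeasure U (x n) (μ n)
  orthogonal : Pairwise fun i j => cyclicSpace U (x i) ⟂ cyclicSpace U (x j)
  total : (⨆ n, cyclicSpace U (x n)).topologicalClosure = ⊤
  chain : ∀ n, μ (n + 1) ≪ μ n

/-- The spectral multiplicity function `M(z) = ∑ₙ 1_{Aₙ}(z)`, where
`Aₙ = {z : (dσ_{xₙ}/dσ_{x₀})(z) ≠ 0}`. -/
def multiplicity (μ : ℕ → Measure Circle) (z : Circle) : ℕ∞ :=
  {n : ℕ | (μ n).rnDeriv (μ 0) z ≠ 0}.encard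

/-- `U` has homogeneous spectrum of multiplicity `N`: the spectral multiplicity function equals `N`
almost everywhere with respect to the maximal spectral type. -/
def HasHomogeneousSpectrum (U : H ≃ₗᵢ[ℂ] H) (N : ℕ) : Prop :=
  ∃ (x : ℕ → H) (μ : ℕ → Measure Circle), IsSpectralDecomposition U x μ ∧
    ∀ᵐ z ∂(μ 0), multiplicity μ z = (N : ℕ∞)

/-- `U` has simple spectrum: it has homogeneous spectrum of multiplicity one. -/
def HasSimpleSpectrum (U : H ≃ₗᵢ[ℂ] H) : Prop := HasHomogeneousSpectrum U 1

end Spectral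

/-! ### The operator `V_σ` -/

theorem memLp_circle_mul (σ : Measure Circle) (u : Circle → Circle) (hu : Continuous u)
    (f : Lp ℂ 2 σ) : MemLp (fun z => (u z : ℂ) * f z) 2 σ := by
  have hm : AEStronglyMeasurable (fun z => (u z : ℂ)) σ :=
    (by fun_prop : Continuous fun z => (u z : ℂ)).aestronglyMeasurable
  refine (Lp.memLp f).of_le (hm.mul (Lp.aestronglyMeasurable f)) (ae_of_all _ fun z => ?_)
  rw [norm_mul, Circle.norm_coe, one_mul]

/-- Multiplication by `z` on `L²(𝕋, σ)`: the unitary operator `(V_σ f)(z) = z f(z)`. -/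
def V (σ : Measure Circle) : Lp ℂ 2 σ ≃ₗᵢ[ℂ] Lp ℂ 2 σ where
  toFun f := (memLp_circle_mul σ (fun z => z) continuous_id f).toLp _
  invFun f := (memLp_circle_mul σ (fun z => z⁻¹) continuous_inv f).toLp _
  map_add' f g := by
    apply Lp.ext
    filter_upwards [MemLp.coeFn_toLp (memLp_circle_mul σ (fun z => z) continuous_id f),
      MemLp.coeFn_toLp (memLp_circle_mul σ (fun z => z) continuous_id g),
      MemLp.coeFn_toLp (memLp_circle_mul σ (fun z => z) continuous_id (f + g)),
      Lp.coeFn_add f g,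
      Lp.coeFn_add ((memLp_circle_mul σ (fun z => z) continuous_id f).toLp _)
        ((memLp_circle_mul σ (fun z => z) continuous_id g).toLp _)] with z h1 h2 h3 h4 h5
    rw [h5, h3, Pi.add_apply, h1, h2, h4, Pi.add_apply, mul_add]
  map_smul' c f := by
    apply Lp.ext
    filter_upwards [MemLp.coeFn_toLp (memLp_circle_mul σ (fun z => z) continuous_id f),
      MemLp.coeFn_toLp (memLp_circle_mul σ (fun z => z) continuous_id (c • f)),
      Lp.coeFn_smul c f,
      Lp.coeFn_smul c ((memLp_circle_mul σ (fun z => z) continuous_id f).toLp _)]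
      with z h1 h2 h3 h4
    rw [RingHom.id_apply, h4, h2, Pi.smul_apply, h1, h3, Pi.smul_apply, smul_eq_mul, smul_eq_mul,
      mul_left_comm]
  left_inv f := by
    apply Lp.ext
    filter_upwards [MemLp.coeFn_toLp (memLp_circle_mul σ (fun z => z) continuous_id f),
      MemLp.coeFn_toLp (memLp_circle_mul σ (fun z => z⁻¹) continuous_inv
        ((memLp_circle_mul σ (fun z => z) continuous_id f).toLp _))] with z h1 h2
    rw [h2, h1, ← mul_assoc, ← Circle.coe_mul, inv_mul_cancel, Circle.coe_one, one_mul]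
  right_inv f := by
    apply Lp.ext
    filter_upwards [MemLp.coeFn_toLp (memLp_circle_mul σ (fun z => z⁻¹) continuous_inv f),
      MemLp.coeFn_toLp (memLp_circle_mul σ (fun z => z) continuous_id
        ((memLp_circle_mul σ (fun z => z⁻¹) continuous_inv f).toLp _))] with z h1 h2
    rw [h2, h1, ← mul_assoc, ← Circle.coe_mul, mul_inv_cancel, Circle.coe_one, one_mul]
  norm_map' f := by
    change ‖(memLp_circle_mul σ (fun z => z) continuous_id f).toLp _‖ = ‖f‖
    rw [Lp.norm_toLp, Lp.norm_def]
    congr 1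
    exact eLpNorm_congr_norm_ae (ae_of_all _ fun z => by rw [norm_mul, Circle.norm_coe, one_mul])

theorem V_apply (σ : Measure Circle) (f : Lp ℂ 2 σ) :
    ∀ᵐ z ∂σ, V σ f z = (z : ℂ) * f z :=
  MemLp.coeFn_toLp (memLp_circle_mul σ (fun z => z) continuous_id f)

/-! ### Tensor powers of a Hilbert space -/

section Tensor

variable (n : ℕ) (H : Type*) [NormedAddCommGroup H] [InnerProductSpace ℂ H]

/-- The algebraic tensor power `H ⊗ ⋯ ⊗ H` (`n` factors). It is a type synonym since it will carry
the Hilbertian norm and not the projective one. -/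
def AlgTensor : Type _ := ⨂[ℂ] _ : Fin n, H

instance AlgTensor.instAddCommGroup : AddCommGroup (AlgTensor n H) :=
  inferInstanceAs (AddCommGroup (⨂[ℂ] _ : Fin n, H))

instance AlgTensor.instModule : Module ℂ (AlgTensor n H) :=
  inferInstanceAs (Module ℂ (⨂[ℂ] _ : Fin n, H))

variable {n H}

/-- The simple tensor `x₁ ⊗ ⋯ ⊗ xₙ`. -/
def AlgTensor.tmul (x : Fin n → H) : AlgTensor n H := PiTensorProduct.tprod ℂ x

theorem AlgTensor.induction {p : AlgTensor n H → Prop} (t : AlgTensor n H)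
    (smul_tmul : ∀ (c : ℂ) (x : Fin n → H), p (c • AlgTensor.tmul x))
    (add : ∀ s t, p s → p t → p (s + t)) : p t :=
  PiTensorProduct.induction_on (motive := p) t smul_tmul add

/-- The linear functional `x₁ ⊗ ⋯ ⊗ xₙ ↦ ∏ ⟨yᵢ, xᵢ⟩`. -/
def AlgTensor.innerLeft (y : Fin n → H) : AlgTensor n H →ₗ[ℂ] ℂ :=
  PiTensorProduct.lift
    ((MultilinearMap.mkPiAlgebra ℂ (Fin n) ℂ).compLinearMap fun i => innerₛₗ ℂ (y i))

theorem AlgTensor.innerLeft_tmul (y x : Fin n → H) :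
    AlgTensor.innerLeft y (AlgTensor.tmul x) = ∏ i, inner ℂ (y i) (x i) := by
  refine (PiTensorProduct.lift.tprod _).trans ?_
  simp

/-- The sesquilinear form with `⟨x₁ ⊗ ⋯ ⊗ xₙ, y₁ ⊗ ⋯ ⊗ yₙ⟩ = ∏ ⟨xᵢ, yᵢ⟩`, linear in `y`, as a map
`y ↦ (x ↦ ⟨x, y⟩)`. -/
def AlgTensor.form : AlgTensor n H →ₗ[ℂ] (AlgTensor n H →ₗ⋆[ℂ] ℂ) :=
  PiTensorProduct.lift
    { toFun := fun y =>
        { toFun := fun t => conj (AlgTensor.innerLeft y t)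
          map_add' := fun s t => by simp
          map_smul' := fun c t => by simp }
      map_update_add' := by
        intro _ y i a b
        ext t
        induction t using AlgTensor.induction with
        | smul_tmul c x =>
          simp only [LinearMap.coe_mk, AddHom.coe_mk, LinearMap.add_apply, map_smul,
            AlgTensor.innerLeft_tmul, smul_eq_mul, map_mul, map_prod, inner_conj_symm]
          rw [← mul_add]
          congr 1
          have := ((MultilinearMap.mkPiAlgebra ℂ (Fin n) ℂ).compLinearMap
            fun i => innerₛₗ ℂ (x i)).map_update_add y i a b
          simpa only [MultilinearMap.compLinearMap_apply, MultilinearMap.mkPiAlgebra_apply,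
            innerₛₗ_apply_apply, smul_eq_mul] using this
        | add s t hs ht =>
          rw [map_add, map_add, hs, ht]
      map_update_smul' := by
        intro _ y i a b
        ext t
        induction t using AlgTensor.induction with
        | smul_tmul c x =>
          simp only [LinearMap.coe_mk, AddHom.coe_mk, LinearMap.smul_apply, map_smul,
            AlgTensor.innerLeft_tmul, smul_eq_mul, map_mul, map_prod, inner_conj_symm]
          rw [mul_left_comm]
          congr 1
          have := ((MultilinearMap.mkPiAlgebra ℂ (Fin n) ℂ).compLinearMap
            fun i => innerₛₗ ℂ (x i)).map_update_smul y i a b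
          simpa only [MultilinearMap.compLinearMap_apply, MultilinearMap.mkPiAlgebra_apply,
            innerₛₗ_apply_apply, smul_eq_mul] using this
        | add s t hs ht =>
          rw [map_add, map_add, hs, ht] }

theorem AlgTensor.form_tmul (x y : Fin n → H) :
    AlgTensor.form (AlgTensor.tmul y) (AlgTensor.tmul x) = ∏ i, inner ℂ (x i) (y i) := by
  have : AlgTensor.form (AlgTensor.tmul y) (AlgTensor.tmul x) =
      conj (AlgTensor.innerLeft y (AlgTensor.tmul x)) := by
    simp only [AlgTensor.form, AlgTensor.tmul]
    erw [PiTensorProduct.lift.tprod]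
    rfl
  rw [this, AlgTensor.innerLeft_tmul, map_prod]
  simp only [inner_conj_symm]

theorem AlgTensor.form_conj (s t : AlgTensor n H) :
    conj (AlgTensor.form s t) = AlgTensor.form t s := by
  induction s using AlgTensor.induction with
  | smul_tmul c x =>
    induction t using AlgTensor.induction with
    | smul_tmul d y =>
      simp only [map_smul, LinearMap.map_smulₛₗ, LinearMap.smul_apply, AlgTensor.form_tmul,
        smul_eq_mul, map_mul, map_prod, inner_conj_symm, Complex.conj_conj]
      ring
    | add s t hs ht => simp only [map_add, LinearMap.add_apply, hs, ht]
  | add s t hs ht => simp only [map_add, LinearMap.add_apply, hs, ht]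

theorem AlgTensor.posSemidef_prod_gram {ι : Type*} [Finite ι] (x : ι → Fin n → H)
    (s : Finset (Fin n)) :
    (Matrix.of fun a b => ∏ i ∈ s, inner ℂ (x a i) (x b i) : Matrix ι ι ℂ).PosSemidef := by
  classical
  induction s using Finset.induction_on with
  | empty =>
    have h : (Matrix.of fun a b => ∏ i ∈ ∅, inner ℂ (x a i) (x b i) : Matrix ι ι ℂ) =
        Matrix.gram ℂ (fun _ : ι => (1 : ℂ)) := by
      ext a b
      simp [Matrix.gram]
    rw [h]
    exact Matrix.posSemidef_gram ℂ _
  | insert i s hi ih =>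
    have h : (Matrix.of fun a b => ∏ i ∈ insert i s, inner ℂ (x a i) (x b i) : Matrix ι ι ℂ) =
        (Matrix.gram ℂ (fun a => x a i)).hadamard
          (Matrix.of fun a b => ∏ i ∈ s, inner ℂ (x a i) (x b i)) := by
      ext a b
      simp [Matrix.gram, Finset.prod_insert hi]
    rw [h]
    exact (Matrix.posSemidef_gram ℂ _).hadamard ih

theorem AlgTensor.form_self_nonneg (t : AlgTensor n H) : 0 ≤ (AlgTensor.form t t).re := by
  have ht : t ∈ Submodule.span ℂ (Set.range (AlgTensor.tmul : (Fin n → H) → AlgTensor n H)) := by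
    have := PiTensorProduct.span_tprod_eq_top (R := ℂ) (s := fun _ : Fin n => H)
    exact this ▸ Submodule.mem_top (x := t)
  obtain ⟨c, rfl⟩ := Finsupp.mem_span_range_iff_exists_finsupp.1 ht
  have key := (AlgTensor.posSemidef_prod_gram (fun a : c.support => (a : Fin n → H))
    Finset.univ).dotProduct_mulVec_nonneg (fun a => c a)
  have hre := (Complex.nonneg_iff.1 key).1
  refine hre.trans_eq ?_
  congr 1
  simp only [Finsupp.sum, map_sum, map_smul, LinearMap.sum_apply, LinearMap.smul_apply,
    LinearMap.map_smulₛₗ, AlgTensor.form_tmul, dotProduct, Matrix.mulVec, Matrix.of_apply,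
    smul_eq_mul, Pi.star_apply, Finset.mul_sum]
  rw [← Finset.sum_coe_sort c.support]
  refine Finset.sum_congr rfl fun b _ => ?_
  rw [← Finset.sum_coe_sort c.support]
  refine Finset.sum_congr rfl fun a _ => ?_
  simp only [Complex.star_def]
  ring

variable (n H) in
/-- The semi-inner product on the algebraic tensor power. -/
@[reducible]
def AlgTensor.core : PreInnerProductSpace.Core ℂ (AlgTensor n H) where
  inner s t := AlgTensor.form t s
  conj_inner_symm s t := AlgTensor.form_conj s t
  re_inner_nonneg t := AlgTensor.form_self_nonneg t
  add_left s t r := map_add (AlgTensor.form r) s t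
  smul_left s t c := (AlgTensor.form t).map_smulₛₗ c s

instance AlgTensor.instSeminormedAddCommGroup : SeminormedAddCommGroup (AlgTensor n H) :=
  @InnerProductSpace.Core.toSeminormedAddCommGroup ℂ _ _ _ _ (AlgTensor.core n H)

instance AlgTensor.instInnerProductSpace : InnerProductSpace ℂ (AlgTensor n H) :=
  InnerProductSpace.ofCore (AlgTensor.core n H)

theorem AlgTensor.inner_tmul (x y : Fin n → H) :
    inner ℂ (AlgTensor.tmul x) (AlgTensor.tmul y) = ∏ i, inner ℂ (x i) (y i) :=
  AlgTensor.form_tmul x y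

theorem AlgTensor.norm_map_of_tmul (e : AlgTensor n H →ₗ[ℂ] AlgTensor n H)
    (he : ∀ x y : Fin n → H, inner ℂ (e (AlgTensor.tmul x)) (e (AlgTensor.tmul y)) =
      inner ℂ (AlgTensor.tmul x) (AlgTensor.tmul y)) (t : AlgTensor n H) : ‖e t‖ = ‖t‖ := by
  have key : ∀ s t : AlgTensor n H, inner ℂ (e s) (e t) = inner ℂ s t := by
    intro s t
    induction s using AlgTensor.induction with
    | smul_tmul c x =>
      induction t using AlgTensor.induction with
      | smul_tmul d y => simp only [map_smul, inner_smul_left, inner_smul_right, he]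
      | add s t hs ht => simp only [map_add, inner_add_right, hs, ht]
    | add s t hs ht => simp only [map_add, inner_add_left, hs, ht]
  rw [norm_eq_sqrt_re_inner (𝕜 := ℂ), norm_eq_sqrt_re_inner (𝕜 := ℂ), key]

/-- `U ⊗ ⋯ ⊗ U` on the algebraic tensor power. -/
def AlgTensor.map (U : H ≃ₗᵢ[ℂ] H) (n : ℕ) : AlgTensor n H ≃ₗᵢ[ℂ] AlgTensor n H :=
  let e : AlgTensor n H ≃ₗ[ℂ] AlgTensor n H :=
    PiTensorProduct.congr fun _ : Fin n => U.toLinearEquiv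
  have he : ∀ x : Fin n → H, e (AlgTensor.tmul x) = AlgTensor.tmul fun i => U (x i) :=
    fun x => PiTensorProduct.congr_tprod (fun _ : Fin n => U.toLinearEquiv) x
  ⟨e, AlgTensor.norm_map_of_tmul e.toLinearMap fun x y => by
    simp only [LinearEquiv.coe_coe, he, AlgTensor.inner_tmul, LinearIsometryEquiv.inner_map_map]⟩

theorem AlgTensor.map_tmul (U : H ≃ₗᵢ[ℂ] H) (x : Fin n → H) :
    AlgTensor.map U n (AlgTensor.tmul x) = AlgTensor.tmul fun i => U (x i) :=
  PiTensorProduct.congr_tprod (fun _ : Fin n => U.toLinearEquiv) x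

variable (H) in
/-- The permutation `x₁ ⊗ ⋯ ⊗ xₙ ↦ x_{π(1)} ⊗ ⋯ ⊗ x_{π(n)}` of the algebraic tensor power. -/
def AlgTensor.perm (π : Equiv.Perm (Fin n)) : AlgTensor n H ≃ₗᵢ[ℂ] AlgTensor n H :=
  let e : AlgTensor n H ≃ₗ[ℂ] AlgTensor n H :=
    PiTensorProduct.reindex ℂ (fun _ : Fin n => H) π.symm
  have he : ∀ x : Fin n → H, e (AlgTensor.tmul x) = AlgTensor.tmul fun i => x (π i) :=
    fun x => PiTensorProduct.reindex_tprod π.symm x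
  ⟨e, AlgTensor.norm_map_of_tmul e.toLinearMap fun x y => by
    simp only [LinearEquiv.coe_coe, he, AlgTensor.inner_tmul]
    exact Equiv.prod_comp π fun i => inner ℂ (x i) (y i)⟩

theorem AlgTensor.perm_tmul (π : Equiv.Perm (Fin n)) (x : Fin n → H) :
    AlgTensor.perm H π (AlgTensor.tmul x) = AlgTensor.tmul fun i => x (π i) :=
  PiTensorProduct.reindex_tprod π.symm x

theorem AlgTensor.map_perm (U : H ≃ₗᵢ[ℂ] H) (π : Equiv.Perm (Fin n)) (t : AlgTensor n H) :
    AlgTensor.map U n (AlgTensor.perm H π t) = AlgTensor.perm H π (AlgTensor.map U n t) := by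
  induction t using AlgTensor.induction with
  | smul_tmul c x => simp only [map_smul, AlgTensor.perm_tmul, AlgTensor.map_tmul]
  | add s t hs ht => simp only [map_add, hs, ht]

/-- The extension of a surjective linear isometry to the completion. -/
def extendCompletion {E : Type*} [SeminormedAddCommGroup E] [InnerProductSpace ℂ E]
    (e : E ≃ₗᵢ[ℂ] E) :
    UniformSpace.Completion E ≃ₗᵢ[ℂ] UniformSpace.Completion E where
  toFun := (e : E →L[ℂ] E).completion
  invFun := (e.symm : E →L[ℂ] E).completion
  map_add' := map_add _
  map_smul' := map_smul _
  left_inv x := by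
    induction x using UniformSpace.Completion.induction_on with
    | hp => exact isClosed_eq (by fun_prop) continuous_id
    | ih x => simp
  right_inv x := by
    induction x using UniformSpace.Completion.induction_on with
    | hp => exact isClosed_eq (by fun_prop) continuous_id
    | ih x => simp
  norm_map' x := by
    change ‖(e : E →L[ℂ] E).completion x‖ = ‖x‖
    induction x using UniformSpace.Completion.induction_on with
    | hp => exact isClosed_eq (by fun_prop) (by fun_prop)
    | ih x => simp

theorem extendCompletion_coe {E : Type*} [SeminormedAddCommGroup E] [InnerProductSpace ℂ E]
    (e : E ≃ₗᵢ[ℂ] E) (x : E) :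
    extendCompletion e (x : UniformSpace.Completion E) = (e x : UniformSpace.Completion E) :=
  (e : E →L[ℂ] E).completion_apply_coe x

variable (n H) in
/-- The Hilbert space tensor power: the completion of the algebraic tensor power for the inner
product with `⟨x₁ ⊗ ⋯ ⊗ xₙ, y₁ ⊗ ⋯ ⊗ yₙ⟩ = ∏ ⟨xᵢ, yᵢ⟩`. -/
abbrev HilbertTensor : Type _ := UniformSpace.Completion (AlgTensor n H)

/-- The unitary operator `U ⊗ ⋯ ⊗ U` (`n` factors) on the Hilbert space tensor power. -/
def tensorPow (U : H ≃ₗᵢ[ℂ] H) (n : ℕ) : HilbertTensor n H ≃ₗᵢ[ℂ] HilbertTensor n H :=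
  extendCompletion (AlgTensor.map U n)

variable (H) in
/-- The unitary operator `x₁ ⊗ ⋯ ⊗ xₙ ↦ x_{π(1)} ⊗ ⋯ ⊗ x_{π(n)}` on the Hilbert space tensor
power. -/
def permOp (π : Equiv.Perm (Fin n)) : HilbertTensor n H ≃ₗᵢ[ℂ] HilbertTensor n H :=
  extendCompletion (AlgTensor.perm H π)

theorem tensorPow_permOp (U : H ≃ₗᵢ[ℂ] H) (π : Equiv.Perm (Fin n)) (t : HilbertTensor n H) :
    tensorPow U n (permOp H π t) = permOp H π (tensorPow U n t) := by
  induction t using UniformSpace.Completion.induction_on with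
  | hp =>
    exact isClosed_eq ((tensorPow U n).continuous.comp (permOp H π).continuous)
      ((permOp H π).continuous.comp (tensorPow U n).continuous)
  | ih t =>
    simp only [tensorPow, permOp, extendCompletion_coe, AlgTensor.map_perm]

variable (n H) in
/-- The symmetric tensor power: the tensors invariant under all permutations. -/
def symTensor : Submodule ℂ (HilbertTensor n H) where
  carrier := {t | ∀ π : Equiv.Perm (Fin n), permOp H π t = t}
  add_mem' hs ht π := by rw [map_add, hs π, ht π]
  zero_mem' π := map_zero _
  smul_mem' c t ht π := by rw [map_smul, ht π]

theorem tensorPow_mem_symTensor (U : H ≃ₗᵢ[ℂ] H) {t : HilbertTensor n H}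
    (ht : t ∈ symTensor n H) : tensorPow U n t ∈ symTensor n H := fun π => by
  rw [← tensorPow_permOp, ht π]

theorem tensorPow_symm_mem_symTensor (U : H ≃ₗᵢ[ℂ] H) {t : HilbertTensor n H}
    (ht : t ∈ symTensor n H) : (tensorPow U n).symm t ∈ symTensor n H := fun π => by
  apply (tensorPow U n).injective
  rw [tensorPow_permOp, LinearIsometryEquiv.apply_symm_apply, ht π]

/-- The restriction of `U ⊗ ⋯ ⊗ U` (`n` factors) to the symmetric tensor power. -/
def symPow (U : H ≃ₗᵢ[ℂ] H) (n : ℕ) : symTensor n H ≃ₗᵢ[ℂ] symTensor n H where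
  toFun t := ⟨tensorPow U n t, tensorPow_mem_symTensor U t.2⟩
  invFun t := ⟨(tensorPow U n).symm t, tensorPow_symm_mem_symTensor U t.2⟩
  map_add' s t := Subtype.ext (map_add (tensorPow U n) (s : HilbertTensor n H) t)
  map_smul' c t := Subtype.ext (map_smul (tensorPow U n) c (t : HilbertTensor n H))
  left_inv t := Subtype.ext ((tensorPow U n).symm_apply_apply t)
  right_inv t := Subtype.ext ((tensorPow U n).apply_symm_apply t)
  norm_map' t := (tensorPow U n).norm_map t

end Tensor

end ConvSing

end

/-!
Simple spectrum provides a cyclic vector, so there is a function `g` on `𝕋ᴺ`, `N = mk`, such that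
every symmetric function of the form `∏ i, f (z i)` equals `P (∏ i, z i) * g z` for some `P`, almost
everywhere. Applied to `∏ i, (c - z i)`, `c ∈ ℕ`, this shows that the product of the coordinates
determines the polynomial `∏ i, (X - z i)`, hence almost every point up to a permutation of its
coordinates.

If `σ^{∗k}` is not singular to `ν = ν₁ ∗ ⋯ ∗ νₙ`, then `ν` is absolutely continuous with respect to
`σ^{∗k}` on a set `B` of positive `ν`-measure. In a random `n × m` array with rows sampled from the
`νᵢ`, all the `mⁿ` products along transversals lie in `B` with positive probability, and they are
almost surely distinct. Each of the `(m!)ⁿ` ways to split the array into `m` transversals then gives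
a vector of products of consecutive blocks of `k` coordinates of a typical point of `𝕋ᴺ`. All these
points have the same product of coordinates, so they are rearrangements of one point, which has at
most `(mk)! / (k!)ᵐ` vectors of block products, while the `(m!)ⁿ` vectors are distinct.
-/

noncomputable section

open MeasureTheory Set Function Filter Topology Equiv

namespace ConvSing

section ProductMeasures

theorem measurePreserving_curry {ι κ X : Type*} [Fintype ι] [Fintype κ] [MeasurableSpace X]
    (μ : ι → κ → Measure X) [∀ i j, SigmaFinite (μ i j)] :
    MeasurePreserving (MeasurableEquiv.curry ι κ X)
      (Measure.pi fun p : ι × κ => μ p.1 p.2) (Measure.pi fun i => Measure.pi (μ i)) := by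
  refine MeasurePreserving.symm (MeasurableEquiv.curry ι κ X).symm ?_
  refine ⟨(MeasurableEquiv.curry ι κ X).symm.measurable, (Measure.pi_eq fun s _ => ?_).symm⟩
  have preimage_box : (MeasurableEquiv.curry ι κ X).symm ⁻¹' univ.pi s =
      univ.pi fun i => univ.pi fun j => s (i, j) := by
    ext z
    simp [MeasurableEquiv.curry]
  rw [MeasurableEquiv.map_apply, preimage_box]
  simp only [Measure.pi_pi, Fintype.prod_prod_type]

theorem measurePreserving_curry_comp {α ι κ X : Type*} [Fintype α] [Fintype ι] [Fintype κ]
    [MeasurableSpace X] (e : ι × κ ≃ α) (μ : α → Measure X) [∀ a, SigmaFinite (μ a)] :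
    MeasurePreserving (fun (z : α → X) i j => z (e (i, j))) (Measure.pi μ)
      (Measure.pi fun i => Measure.pi fun j => μ (e (i, j))) :=
  (measurePreserving_curry fun i j => μ (e (i, j))).comp
    (measurePreserving_piCongrLeft μ e).symm

theorem absolutelyContinuous_pi_fin {n : ℕ} {X : Fin n → Type*} [∀ i, MeasurableSpace (X i)]
    {μ ν : ∀ i, Measure (X i)} [∀ i, SigmaFinite (μ i)] [∀ i, SigmaFinite (ν i)]
    (h : ∀ i, μ i ≪ ν i) : Measure.pi μ ≪ Measure.pi ν := by
  induction n with
  | zero => rw [Subsingleton.elim μ ν]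
  | succ n ih =>
    rw [← ((measurePreserving_piFinSuccAbove μ 0).symm _).map_eq,
      ← ((measurePreserving_piFinSuccAbove ν 0).symm _).map_eq]
    exact ((h 0).prod (ih fun i => h _)).map (MeasurableEquiv.measurable _)

theorem absolutelyContinuous_pi {ι : Type*} [Fintype ι] {X : ι → Type*}
    [∀ i, MeasurableSpace (X i)] {μ ν : ∀ i, Measure (X i)} [∀ i, SigmaFinite (μ i)]
    [∀ i, SigmaFinite (ν i)] (h : ∀ i, μ i ≪ ν i) : Measure.pi μ ≪ Measure.pi ν := by
  let e := (Fintype.equivFin ι).symm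
  rw [← (measurePreserving_piCongrLeft μ e).map_eq, ← (measurePreserving_piCongrLeft ν e).map_eq]
  exact (absolutelyContinuous_pi_fin fun i => h (e i)).map (MeasurableEquiv.measurable _)

theorem pi_null_of_subsingleton_update {ι : Type*} [Fintype ι] [DecidableEq ι] {X : ι → Type*}
    [∀ i, MeasurableSpace (X i)] (μ : ∀ i, Measure (X i)) [∀ i, SigmaFinite (μ i)] (i : ι)
    [NullSingletonClass (μ i)] {S : Set (∀ i, X i)} (hS : MeasurableSet S)
    (h : ∀ y, {t | update y i t ∈ S}.Subsingleton) : Measure.pi μ S = 0 := by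
  rcases isEmpty_or_nonempty (∀ i, X i) with hX | ⟨⟨y₀⟩⟩
  · rw [Set.eq_empty_of_isEmpty S, measure_empty]
  have line_null (y : ∀ i, X i) :
      ∫⁻ t, S.indicator (1 : (∀ i, X i) → ENNReal) (update y i t) ∂μ i = 0 :=
    (lintegral_indicator_one (hS.preimage (measurable_update y))).trans ((h y).measure_zero _)
  rw [← lintegral_indicator_one hS, lintegral_eq_lmarginal_univ y₀,
    ← Finset.insert_erase (Finset.mem_univ i),
    lmarginal_insert' _ (measurable_one.indicator hS) (Finset.notMem_erase i _), funext line_null]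
  simp [lmarginal]

theorem ae_injective_prod_finset {ι M : Type*} [Fintype ι] [CancelCommMonoid M] [MeasurableSpace M]
    [MeasurableMul₂ M] [MeasurableEq M] (μ : ι → Measure M) [∀ i, SigmaFinite (μ i)]
    [∀ i, NullSingletonClass (μ i)] :
    ∀ᵐ z ∂Measure.pi μ, Injective fun s : Finset ι => ∏ a ∈ s, z a := by
  classical
  have pair (s t : Finset ι) (a : ι) (has : a ∈ s) (hat : a ∉ t) :
      ∀ᵐ z ∂Measure.pi μ, ∏ b ∈ s, z b ≠ ∏ b ∈ t, z b := by
    have measurable_prod (s : Finset ι) : Measurable fun z : ι → M => ∏ b ∈ s, z b := by fun_prop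
    have coincidence_null := pi_null_of_subsingleton_update μ a
      (S := {z | ∏ b ∈ s, z b = ∏ b ∈ t, z b})
      (measurableSet_eq_fun (measurable_prod s) (measurable_prod t)) fun y u hu v hv => by
        simp only [mem_ofPred_eq, Finset.prod_update_of_mem has,
          Finset.prod_update_of_notMem hat] at hu hv
        exact mul_right_cancel (hu.trans hv.symm)
    simpa only [ae_iff, not_not] using coincidence_null
  have all_pairs : ∀ᵐ z ∂Measure.pi μ, ∀ (s t : Finset ι), ∀ a ∈ s, a ∉ t →
      ∏ b ∈ s, z b ≠ ∏ b ∈ t, z b := by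
    simp only [ae_all_iff]
    exact fun s t a has hat => pair s t a has hat
  filter_upwards [all_pairs] with z hz s t hst
  refine Finset.Subset.antisymm (fun a ha => ?_) fun a ha => ?_
  · by_contra hat
    exact hz s t a ha hat hst
  · by_contra has
    exact hz t s a ha has hst.symm

theorem ae_injective_prod_transversal {ι κ M : Type*} [Fintype ι] [Fintype κ] [CancelCommMonoid M]
    [MeasurableSpace M] [MeasurableMul₂ M] [MeasurableEq M] (μ : ι × κ → Measure M)
    [∀ a, SigmaFinite (μ a)] [∀ a, NullSingletonClass (μ a)] :
    ∀ᵐ z ∂Measure.pi μ, Injective fun J : ι → κ => ∏ i, z (i, J i) := by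
  let graph (J : ι → κ) : Finset (ι × κ) :=
    Finset.univ.map ⟨fun i => (i, J i), fun _ _ h => congrArg Prod.fst h⟩
  have graph_injective : Injective graph := fun J J' h => by
    funext i
    have : (i, J i) ∈ graph J' := h ▸ Finset.mem_map.2 ⟨i, Finset.mem_univ i, rfl⟩
    obtain ⟨i', -, hi'⟩ := Finset.mem_map.1 this
    obtain ⟨rfl, hJ⟩ := Prod.mk.inj hi'
    exact hJ.symm
  filter_upwards [ae_injective_prod_finset μ] with z hz
  refine fun J J' h => graph_injective (hz ?_)
  simp only [graph, Finset.prod_map]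
  exact h

theorem frequently_ae_prod_iff {X Y : Type*} [MeasurableSpace X] [MeasurableSpace Y]
    {μ : Measure X} {ν : Measure Y} [SFinite ν] {p : X × Y → Prop} (hp : Measurable p) :
    (∃ᵐ q ∂μ.prod ν, p q) ↔ ∃ᵐ x ∂μ, ∃ᵐ y ∂ν, p (x, y) := by
  simpa only [Filter.Frequently, not_not] using
    not_congr (Measure.ae_prod_iff_ae_ae hp.not.setOf)

theorem frequently_ae_prod_iff_swap {X Y : Type*} [MeasurableSpace X] [MeasurableSpace Y]
    {μ : Measure X} {ν : Measure Y} [SFinite μ] [SFinite ν] {p : X × Y → Prop} (hp : Measurable p) :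
    (∃ᵐ q ∂μ.prod ν, p q) ↔ ∃ᵐ y ∂ν, ∃ᵐ x ∂μ, p (x, y) := by
  rw [frequently_ae_prod_iff hp]
  simpa only [Filter.Frequently, not_not] using
    not_congr (Measure.ae_ae_comm (p := fun x y => ¬ p (x, y)) hp.not.setOf)

theorem frequently_ae_pi_forall {κ X : Type*} [Fintype κ] [MeasurableSpace X] {μ : Measure X}
    [SigmaFinite μ] {p : X → Prop} (h : ∃ᵐ x ∂μ, p x) :
    ∃ᵐ x ∂Measure.pi fun _ : κ => μ, ∀ j, p (x j) := by
  rw [frequently_ae_iff] at h ⊢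
  have box : {x : κ → X | ∀ j, p (x j)} = univ.pi fun _ => {x | p x} := by
    ext
    simp
  rw [box, Measure.pi_pi]
  exact Finset.prod_ne_zero_iff.2 fun _ _ => h

theorem frequently_ae_prod_pi_forall {κ X Y : Type*} [Fintype κ] [MeasurableSpace X]
    [MeasurableSpace Y] {μ : Measure X} {ν : Measure Y} [SigmaFinite μ] [SFinite ν]
    {p : X × Y → Prop} (hp : Measurable p) (h : ∃ᵐ q ∂μ.prod ν, p q) :
    ∃ᵐ q ∂(Measure.pi fun _ : κ => μ).prod ν, ∀ j, p (q.1 j, q.2) := by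
  rw [frequently_ae_prod_iff_swap hp] at h
  rw [frequently_ae_prod_iff_swap (by fun_prop)]
  exact h.mono fun y hy => frequently_ae_pi_forall hy

theorem frequently_ae_pi_grid {n : ℕ} {κ X : Type*} [Fintype κ] [MeasurableSpace X]
    {ν : Fin n → Measure X} [∀ i, SigmaFinite (ν i)] {p : (Fin n → X) → Prop}
    (hp : Measurable p) (h : ∃ᵐ x ∂Measure.pi ν, p x) :
    ∃ᵐ y ∂Measure.pi fun i => Measure.pi fun _ : κ => ν i,
      ∀ J : Fin n → κ, p fun i => y i (J i) := by
  induction n with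
  | zero =>
    obtain ⟨x, hx⟩ := h.exists
    have hp' (x' : Fin 0 → X) : p x' := Subsingleton.elim x x' ▸ hx
    rw [Measure.pi_of_empty]
    exact (Eventually.of_forall fun y J => hp' _).frequently
  | succ n ih =>
    have he := (measurePreserving_piFinSuccAbove ν 0).symm
    have he' := (measurePreserving_piFinSuccAbove (fun i => Measure.pi fun _ : κ => ν i) 0).symm
    rw [← he.map_eq, ← MeasurableEquiv.map_ae, frequently_map] at h
    rw [← he'.map_eq, ← MeasurableEquiv.map_ae, frequently_map]
    have grid_zero := frequently_ae_prod_pi_forall (κ := κ) (by fun_prop) h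
    rw [frequently_ae_prod_iff (by fun_prop)] at grid_zero
    rw [frequently_ae_prod_iff (by fun_prop)]
    refine grid_zero.mono fun x hx => (ih (by fun_prop) hx).mono fun y hy J => ?_
    convert hy (Fin.tail J) (J 0) using 1
    ext i
    cases i using Fin.cases <;> simp [Fin.tail]

theorem frequently_ae_pi_transversal {n : ℕ} {κ X : Type*} [Fintype κ] [MeasurableSpace X]
    {ν : Fin n → Measure X} [∀ i, SigmaFinite (ν i)] {p : (Fin n → X) → Prop}
    (hp : Measurable p) (h : ∃ᵐ x ∂Measure.pi ν, p x) :
    ∃ᵐ z ∂Measure.pi fun a : Fin n × κ => ν a.1, ∀ J : Fin n → κ, p fun i => z (i, J i) := by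
  have grid := frequently_ae_pi_grid (κ := κ) hp h
  rwa [← (measurePreserving_curry fun i (_ : κ) => ν i).map_eq, ← MeasurableEquiv.map_ae,
    frequently_map] at grid

theorem exists_restrict_absolutelyContinuous {X : Type*} [MeasurableSpace X] {τ ν : Measure X}
    [ν.HaveLebesgueDecomposition τ] (h : ¬ τ ⟂ₘ ν) :
    ∃ B, MeasurableSet B ∧ ν B ≠ 0 ∧ ν.restrict B ≪ τ := by
  obtain ⟨S, hS, hνS, hτS⟩ := Measure.mutuallySingular_singularPart ν τ
  refine ⟨S, hS, fun h0 => h ⟨Sᶜ, hS.compl, hτS, by rwa [compl_compl]⟩, ?_⟩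
  rw [Measure.haveLebesgueDecomposition_add ν τ, Measure.restrict_add,
    Measure.restrict_eq_zero.2 hνS, zero_add]
  exact Measure.restrict_le_self.absolutelyContinuous.trans (withDensity_absolutelyContinuous _ _)

theorem exists_isSigmaCompact_subset_ae_mem {X : Type*} [TopologicalSpace X] [MeasurableSpace X]
    [BorelSpace X] [T2Space X] {μ : Measure X} [IsFiniteMeasure μ] [μ.InnerRegularCompactLTTop]
    {A : Set X} (hA : ∀ᵐ x ∂μ, x ∈ A) :
    ∃ K ⊆ A, IsSigmaCompact K ∧ ∀ᵐ x ∂μ, x ∈ K := by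
  obtain ⟨N, hAN, hN, hμN⟩ := exists_measurable_superset_of_null (mem_ae_iff.1 hA)
  have compact_approx (l : ℕ) : ∃ K ⊆ Nᶜ, IsCompact K ∧ μ (Nᶜ \ K) < (l : ENNReal)⁻¹ :=
    hN.compl.exists_isCompact_sdiff_lt (measure_ne_top _ _) (by simp)
  choose K hKN hK hμK using compact_approx
  have remainder_null : μ (Nᶜ \ ⋃ l, K l) = 0 := by
    by_contra hne
    obtain ⟨l, hl⟩ := ENNReal.exists_inv_nat_lt hne
    exact (hl.trans_le (measure_mono (sdiff_subset_sdiff_right (subset_iUnion K l)))).not_gt (hμK l)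
  refine ⟨⋃ l, K l, iUnion_subset fun l => (hKN l).trans (compl_subset_comm.1 hAN),
    isSigmaCompact_iUnion_of_isCompact K hK, ?_⟩
  filter_upwards [measure_eq_zero_iff_ae_notMem.1 hμN,
    measure_eq_zero_iff_ae_notMem.1 remainder_null] with x hxN hx
  exact not_not.1 fun hxK => hx ⟨hxN, hxK⟩

theorem ae_map_mem_image {X Y : Type*} [TopologicalSpace X] [MeasurableSpace X]
    [BorelSpace X] [T2Space X] [TopologicalSpace Y] [MeasurableSpace Y] [BorelSpace Y] [T2Space Y]
    {μ : Measure X} [IsFiniteMeasure μ] [μ.InnerRegularCompactLTTop] {q : X → Y}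
    (hq : Continuous q) {A : Set X} (hA : ∀ᵐ x ∂μ, x ∈ A) : ∀ᵐ y ∂μ.map q, y ∈ q '' A := by
  -- `q '' A` need not be measurable.
  obtain ⟨K, hKA, hK, hμK⟩ := exists_isSigmaCompact_subset_ae_mem hA
  have hqK : MeasurableSet (q '' K) := by
    obtain ⟨C, hC, hCK⟩ := hK.image hq
    exact hCK ▸ MeasurableSet.iUnion fun l => (hC l).measurableSet
  have := (ae_map_iff hq.measurable.aemeasurable hqK).2 (hμK.mono fun x => mem_image_of_mem q)
  exact this.mono fun y hy => image_mono hKA hy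

end ProductMeasures

section BlockProducts

variable {ι κ τ α M : Type*}

/-- The products of the coordinates of `z` over the blocks `e '' ({j} × τ)` into which `e` splits
the index set. -/
def blockProd [Fintype τ] [CommMonoid M] (e : κ × τ ≃ α) (z : α → M) (j : κ) : M :=
  ∏ l, z (e (j, l))

theorem prod_blockProd [Fintype κ] [Fintype τ] [Fintype α] [CommMonoid M] (e : κ × τ ≃ α)
    (z : α → M) :
    ∏ j, blockProd e z j = ∏ a, z a := by
  rw [← e.prod_comp, Fintype.prod_prod_type]
  rfl

/-- The permutation of the index set permuting the block of `j` by `θ j`. -/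
def blockPerm (e : κ × τ ≃ α) (θ : κ → Perm τ) : Perm α :=
  e.permCongr (prodCongrRight θ)

theorem blockPerm_apply (e : κ × τ ≃ α) (θ : κ → Perm τ) (j : κ) (l : τ) :
    blockPerm e θ (e (j, l)) = e (j, θ j l) := by
  simp only [blockPerm, permCongr_apply, symm_apply_apply, prodCongrRight_apply]

theorem blockPerm_injective (e : κ × τ ≃ α) : Injective (blockPerm e) := fun θ θ' h => by
  ext j l
  have := DFunLike.congr_fun h (e (j, l))
  simpa only [blockPerm_apply, e.apply_eq_iff_eq, Prod.mk.injEq, true_and] using this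

theorem blockProd_comp_blockPerm [Fintype τ] [CommMonoid M] (e : κ × τ ≃ α) (z : α → M)
    (θ : κ → Perm τ) :
    blockProd e (z ∘ blockPerm e θ) = blockProd e z := by
  funext j
  simp only [blockProd, comp_apply, blockPerm_apply]
  exact Equiv.prod_comp (θ j) fun l => z (e (j, l))

/-- The enumeration of an array by the transversals `{(i, π i j) | i}`, one for each column `j`. -/
def transversalEquiv (π : ι → Perm κ) : κ × ι ≃ ι × κ :=
  (prodComm κ ι).trans (prodCongrRight π)

/-- On `A`, a point is determined by the product of its coordinates up to a permutation of the
coordinates. -/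
def DeterminedByProd [Fintype α] [CommMonoid M] (A : Set (α → M)) : Prop :=
  ∀ z ∈ A, ∀ w ∈ A, ∏ a, z a = ∏ a, w a → ∃ ρ : Perm α, w = z ∘ ρ

variable [Fintype ι] [Fintype κ] [Fintype τ] [Fintype α] [CommMonoid M]

theorem card_mul_factorial_pow_le (e : κ × τ ≃ α) (z : α → M) (ρ : ι → Perm α)
    (hρ : Injective fun c => blockProd e (z ∘ ρ c)) :
    Fintype.card ι * (Fintype.card τ).factorial ^ Fintype.card κ ≤
      (Fintype.card α).factorial := by
  classical
  have perm_injective : Injective fun p : ι × (κ → Perm τ) => ρ p.1 * blockPerm e p.2 := by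
    rintro ⟨c, θ⟩ ⟨c', θ'⟩ (h : ρ c * blockPerm e θ = ρ c' * blockPerm e θ')
    have hblock (c : ι) (θ : κ → Perm τ) :
        blockProd e (z ∘ ⇑(ρ c * blockPerm e θ)) = blockProd e (z ∘ ρ c) :=
      blockProd_comp_blockPerm e (z ∘ ρ c) θ
    obtain rfl : c = c' := hρ (by simp only [← hblock c θ, ← hblock c' θ', h])
    exact Prod.ext rfl (blockPerm_injective e (mul_left_cancel h))
  simpa [Fintype.card_perm] using Fintype.card_le_of_injective _ perm_injective

theorem DeterminedByProd.factorial_pow_mul_factorial_pow_le {A : Set (α → M)}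
    (hA : DeterminedByProd A) (e : κ × τ ≃ α) {z : ι × κ → M}
    (hz : Injective fun J : ι → κ => ∏ i, z (i, J i))
    (hzA : ∀ π : ι → Perm κ, blockProd (transversalEquiv π) z ∈ blockProd e '' A) :
    (Fintype.card κ).factorial ^ Fintype.card ι * (Fintype.card τ).factorial ^ Fintype.card κ ≤
      (Fintype.card α).factorial := by
  classical
  choose w hwA hw using hzA
  have prod_w (π : ι → Perm κ) : ∏ a, w π a = ∏ a, z a := by
    rw [← prod_blockProd e, hw, prod_blockProd]
  choose ρ hρ using fun π =>
    hA (w 1) (hwA 1) (w π) (hwA π) ((prod_w 1).trans (prod_w π).symm)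
  have rearrangements_injective : Injective fun π => blockProd e (w 1 ∘ ρ π) := fun π π' h => by
    simp only [← hρ, hw] at h
    ext i j
    exact congrFun (hz (congrFun h j)) i
  simpa [Fintype.card_perm] using card_mul_factorial_pow_le e (w 1) ρ rearrangements_injective

end BlockProducts

section Singularity

variable {G : Type*} [CommMonoid G] [MeasurableSpace G] [MeasurableMul₂ G]

/-- The law of a product of independent samples of the `ν i`. It is `conv ν` on the circle. -/
def prodLaw {ι : Type*} [Fintype ι] (ν : ι → Measure G) : Measure G :=
  (Measure.pi ν).map fun z => ∏ i, z i

instance prodLaw.instIsFiniteMeasure {ι : Type*} [Fintype ι] (ν : ι → Measure G)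
    [∀ i, IsFiniteMeasure (ν i)] : IsFiniteMeasure (prodLaw ν) := by
  unfold prodLaw
  infer_instance

theorem measurePreserving_blockProd {κ τ α : Type*} [Fintype κ] [Fintype τ] [Fintype α]
    (e : κ × τ ≃ α) (μ : α → Measure G) [∀ a, IsFiniteMeasure (μ a)] :
    MeasurePreserving (blockProd e) (Measure.pi μ)
      (Measure.pi fun j => prodLaw fun l => μ (e (j, l))) := by
  have block_law (j : κ) : MeasurePreserving (fun x : τ → G => ∏ l, x l)
      (Measure.pi fun l => μ (e (j, l))) (prodLaw fun l => μ (e (j, l))) :=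
    Measurable.measurePreserving (by fun_prop) _
  exact (measurePreserving_pi _ _ block_law).comp (measurePreserving_curry_comp e μ)

theorem ae_blockProd_mem_of_restrict_absolutelyContinuous {ι κ α : Type*} [Fintype ι] [Fintype κ]
    [Fintype α] (e : κ × ι ≃ α) (μ : α → Measure G) [∀ a, IsFiniteMeasure (μ a)]
    {ν η : Measure G} [IsFiniteMeasure ν] [IsFiniteMeasure η]
    (hμ : ∀ j, prodLaw (fun i => μ (e (j, i))) = ν) {B : Set G} (hB : MeasurableSet B)
    (hνB : ν.restrict B ≪ η) {C : Set (κ → G)} (hC : ∀ᵐ x ∂Measure.pi fun _ : κ => η, x ∈ C) :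
    ∀ᵐ z ∂Measure.pi μ, (∀ j, blockProd e z j ∈ B) → blockProd e z ∈ C := by
  have restricted : ∀ᵐ x ∂Measure.pi fun _ : κ => ν.restrict B, x ∈ C :=
    (absolutelyContinuous_pi fun _ => hνB).ae_le hC
  rw [← Measure.restrict_pi_pi, ae_restrict_iff' (MeasurableSet.univ_pi fun _ => hB)] at restricted
  have hlaw := measurePreserving_blockProd e μ
  simp only [hμ] at hlaw
  filter_upwards [hlaw.quasiMeasurePreserving.ae restricted] with z hz hzB
  exact hz fun j _ => hzB j

theorem exists_forall_transversal_mem_of_not_mutuallySingular {G : Type*} [CancelCommMonoid G]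
    [MeasurableSpace G] [MeasurableMul₂ G] [MeasurableEq G] {n : ℕ} {κ : Type*} [Fintype κ]
    {ν : Fin n → Measure G} [∀ i, IsFiniteMeasure (ν i)] [∀ i, NullSingletonClass (ν i)]
    {η : Measure G} [IsFiniteMeasure η] (h : ¬ η ⟂ₘ prodLaw ν) {C : Set (κ → G)}
    (hC : ∀ᵐ x ∂Measure.pi fun _ : κ => η, x ∈ C) :
    ∃ z : Fin n × κ → G, Injective (fun J : Fin n → κ => ∏ i, z (i, J i)) ∧
      ∀ π : Fin n → Perm κ, blockProd (transversalEquiv π) z ∈ C := by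
  obtain ⟨B, hB, hBpos, hBac⟩ := exists_restrict_absolutelyContinuous h
  have sample_in_B : ∃ᵐ x ∂Measure.pi ν, ∏ i, x i ∈ B := by
    rw [prodLaw, Measure.map_apply (by fun_prop) hB] at hBpos
    exact frequently_ae_iff.2 hBpos
  have array_in_B := frequently_ae_pi_transversal (κ := κ) (by fun_prop) sample_in_B
  have array_in_C : ∀ᵐ z ∂Measure.pi fun a : Fin n × κ => ν a.1, ∀ π : Fin n → Perm κ,
      (∀ j, blockProd (transversalEquiv π) z j ∈ B) → blockProd (transversalEquiv π) z ∈ C :=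
    ae_all_iff.2 fun π => ae_blockProd_mem_of_restrict_absolutelyContinuous (transversalEquiv π) _
      (fun _ => rfl) hB hBac hC
  obtain ⟨z, hzB, hzC, hz⟩ :=
    (array_in_B.and_eventually (array_in_C.and (ae_injective_prod_transversal _))).exists
  exact ⟨z, hz, fun π => hzC π fun j => hzB fun i => π i j⟩

theorem mutuallySingular_prodLaw_of_determinedByProd {G : Type*} [CancelCommMonoid G]
    [TopologicalSpace G] [PolishSpace G] [MeasurableSpace G] [BorelSpace G] [ContinuousMul G]
    {κ τ α : Type*} [Fintype κ] [Fintype τ] [Fintype α] (e : κ × τ ≃ α) (σ : Measure G)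
    [IsFiniteMeasure σ] {A : Set (α → G)} (hA : DeterminedByProd A)
    (hσA : ∀ᵐ z ∂Measure.pi fun _ : α => σ, z ∈ A) {n : ℕ} (ν : Fin n → Measure G)
    [∀ i, IsFiniteMeasure (ν i)] [∀ i, NullSingletonClass (ν i)]
    (hcard : (Fintype.card α).factorial <
      (Fintype.card κ).factorial ^ n * (Fintype.card τ).factorial ^ Fintype.card κ) :
    prodLaw (fun _ : τ => σ) ⟂ₘ prodLaw ν := by
  have continuous_blockProd : Continuous (blockProd e : (α → G) → κ → G) := by
    unfold blockProd
    fun_prop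
  have block_image : ∀ᵐ x ∂Measure.pi fun _ : κ => prodLaw fun _ : τ => σ,
      x ∈ blockProd e '' A := by
    rw [← (measurePreserving_blockProd e fun _ => σ).map_eq]
    exact ae_map_mem_image continuous_blockProd hσA
  by_contra h
  obtain ⟨z, hz, hzA⟩ := exists_forall_transversal_mem_of_not_mutuallySingular h block_image
  have := hA.factorial_pow_mul_factorial_pow_le e hz hzA
  rw [Fintype.card_fin] at this
  exact hcard.not_ge this

end Singularity

section TensorPowers

variable {N : ℕ} {H : Type*} [NormedAddCommGroup H] [InnerProductSpace ℂ H]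

/-- The linear map on the algebraic tensor power induced by a multilinear map. -/
def AlgTensor.lift {E : Type*} [AddCommMonoid E] [Module ℂ E]
    (φ : MultilinearMap ℂ (fun _ : Fin N => H) E) : AlgTensor N H →ₗ[ℂ] E :=
  PiTensorProduct.lift φ

theorem AlgTensor.lift_tmul {E : Type*} [AddCommMonoid E] [Module ℂ E]
    (φ : MultilinearMap ℂ (fun _ : Fin N => H) E) (x : Fin N → H) :
    AlgTensor.lift φ (AlgTensor.tmul x) = φ x :=
  PiTensorProduct.lift.tprod x

theorem AlgTensor.norm_lift {E : Type*} [SeminormedAddCommGroup E] [InnerProductSpace ℂ E]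
    {φ : MultilinearMap ℂ (fun _ : Fin N => H) E}
    (hφ : ∀ x y, inner ℂ (φ x) (φ y) = ∏ i, inner ℂ (x i) (y i)) (t : AlgTensor N H) :
    ‖AlgTensor.lift φ t‖ = ‖t‖ := by
  have inner_lift (s t : AlgTensor N H) :
      inner ℂ (AlgTensor.lift φ s) (AlgTensor.lift φ t) = inner ℂ s t := by
    induction s using AlgTensor.induction with
    | smul_tmul c x =>
      induction t using AlgTensor.induction with
      | smul_tmul d y =>
        simp only [map_smul, inner_smul_left, inner_smul_right, lift_tmul, hφ, inner_tmul]
      | add s t hs ht => simp only [map_add, inner_add_right, hs, ht]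
    | add s t hs ht => simp only [map_add, inner_add_left, hs, ht]
  rw [norm_eq_sqrt_re_inner (𝕜 := ℂ), norm_eq_sqrt_re_inner (𝕜 := ℂ), inner_lift]

/-- The continuous linear map on the Hilbert space tensor power induced by a multilinear map which
multiplies inner products. -/
def hilbertLift {E : Type*} [NormedAddCommGroup E] [InnerProductSpace ℂ E] [CompleteSpace E]
    (φ : MultilinearMap ℂ (fun _ : Fin N => H) E)
    (hφ : ∀ x y, inner ℂ (φ x) (φ y) = ∏ i, inner ℂ (x i) (y i)) : HilbertTensor N H →L[ℂ] E :=
  ((AlgTensor.lift φ).mkContinuous 1 fun t => by rw [AlgTensor.norm_lift hφ, one_mul]).extend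
    UniformSpace.Completion.toComplL

theorem hilbertLift_tmul {E : Type*} [NormedAddCommGroup E] [InnerProductSpace ℂ E]
    [CompleteSpace E] (φ : MultilinearMap ℂ (fun _ : Fin N => H) E)
    (hφ : ∀ x y, inner ℂ (φ x) (φ y) = ∏ i, inner ℂ (x i) (y i)) (x : Fin N → H) :
    hilbertLift φ hφ (AlgTensor.tmul x : AlgTensor N H) = φ x :=
  (ContinuousLinearMap.extend_eq _ UniformSpace.Completion.denseRange_coe
    (UniformSpace.Completion.isUniformInducing_coe _) _).trans (AlgTensor.lift_tmul φ x)

theorem hilbertTensor_hom_ext {E : Type*} [AddCommMonoid E] [Module ℂ E] [TopologicalSpace E]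
    [T2Space E] {S T : HilbertTensor N H →L[ℂ] E}
    (h : ∀ x : Fin N → H, S (AlgTensor.tmul x : AlgTensor N H) =
      T (AlgTensor.tmul x : AlgTensor N H)) : S = T := by
  ext t
  induction t using UniformSpace.Completion.induction_on with
  | hp => exact isClosed_eq S.continuous T.continuous
  | ih t =>
    induction t using AlgTensor.induction with
    | smul_tmul c x => simp only [UniformSpace.Completion.coe_smul, map_smul, h]
    | add s t hs ht => simp only [UniformSpace.Completion.coe_add, map_add, hs, ht]

theorem tensorPow_tmul (U : H ≃ₗᵢ[ℂ] H) (x : Fin N → H) :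
    tensorPow U N (AlgTensor.tmul x : AlgTensor N H) =
      (AlgTensor.tmul fun i => U (x i) : AlgTensor N H) := by
  rw [tensorPow, extendCompletion_coe, AlgTensor.map_tmul]

theorem tmul_const_mem_symTensor (x : H) :
    ((AlgTensor.tmul fun _ => x : AlgTensor N H) : HilbertTensor N H) ∈ symTensor N H := fun π => by
  rw [permOp, extendCompletion_coe, AlgTensor.perm_tmul]

end TensorPowers

section ProductFunctions

variable {ι : Type*} [Fintype ι] {X : ι → Type*} [∀ i, MeasurableSpace (X i)]
  {μ : ∀ i, Measure (X i)} [∀ i, SigmaFinite (μ i)]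

theorem ae_pi_forall_eval {p : ∀ i, X i → Prop} (h : ∀ i, ∀ᵐ x ∂μ i, p i x) :
    ∀ᵐ z ∂Measure.pi μ, ∀ i, p i (z i) :=
  ae_all_iff.2 fun i => (Measure.quasiMeasurePreserving_eval μ i).ae (h i)

variable {𝕜 : Type*} [RCLike 𝕜]

theorem memLp_two_prod_eval (f : ∀ i, Lp 𝕜 2 (μ i)) :
    MemLp (fun z => ∏ i, f i (z i)) 2 (Measure.pi μ) := by
  have aestronglyMeasurable_prod :
      AEStronglyMeasurable (fun z => ∏ i, f i (z i)) (Measure.pi μ) :=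
    Finset.aestronglyMeasurable_fun_prod _ fun i _ =>
      (Lp.aestronglyMeasurable (f i)).comp_quasiMeasurePreserving
        (Measure.quasiMeasurePreserving_eval μ i)
  rw [memLp_two_iff_integrable_sq_norm aestronglyMeasurable_prod]
  simp only [norm_prod, ← Finset.prod_pow]
  exact Integrable.fintype_prod_dep fun i =>
    (memLp_two_iff_integrable_sq_norm (Lp.aestronglyMeasurable (f i))).1 (Lp.memLp (f i))

/-- The function `z ↦ ∏ i, f i (z i)` in `L²`, as a multilinear map in `f`. -/
def prodLp : MultilinearMap 𝕜 (fun i => Lp 𝕜 2 (μ i)) (Lp 𝕜 2 (Measure.pi μ)) where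
  toFun f := (memLp_two_prod_eval f).toLp _
  map_update_add' f i a b := by
    rw [← MemLp.toLp_add, MemLp.toLp_eq_toLp_iff]
    filter_upwards [Measure.tendsto_eval_ae_ae.eventually (Lp.coeFn_add a b)] with z hz
    simp only [Pi.add_apply, apply_update fun j (g : Lp 𝕜 2 (μ j)) => g (z j),
      Finset.prod_update_of_mem (Finset.mem_univ i), ← add_mul]
    exact congrArg (· * _) hz
  map_update_smul' f i c a := by
    rw [← MemLp.toLp_const_smul, MemLp.toLp_eq_toLp_iff]
    filter_upwards [Measure.tendsto_eval_ae_ae.eventually (Lp.coeFn_smul c a)] with z hz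
    simp only [Pi.smul_apply, apply_update fun j (g : Lp 𝕜 2 (μ j)) => g (z j),
      Finset.prod_update_of_mem (Finset.mem_univ i), ← smul_mul_assoc]
    exact congrArg (· * _) hz

theorem coeFn_prodLp (f : ∀ i, Lp 𝕜 2 (μ i)) :
    prodLp f =ᵐ[Measure.pi μ] fun z => ∏ i, f i (z i) :=
  MemLp.coeFn_toLp (memLp_two_prod_eval f)

theorem inner_prodLp (f g : ∀ i, Lp 𝕜 2 (μ i)) :
    inner 𝕜 (prodLp f) (prodLp g) = ∏ i, inner 𝕜 (f i) (g i) := by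
  simp only [L2.inner_def]
  rw [← integral_fintype_prod_eq_prod]
  refine integral_congr_ae ?_
  filter_upwards [coeFn_prodLp f, coeFn_prodLp g] with z hf hg
  simp only [hf, hg, RCLike.inner_apply, map_prod, Finset.prod_mul_distrib]

end ProductFunctions

section FiberMultiples

variable {X Y 𝕜 : Type*} [MeasurableSpace X] [NormedField 𝕜] (p : ENNReal) (μ : Measure X)

/-- The functions in `Lᵖ` of the form `z ↦ P (q z) * g z`: the multiples of `g` by functions which
are constant on the fibres of `q`. Neither `P` nor `q` is required to be measurable. -/
def fiberMultiples (q : X → Y) (g : X → 𝕜) : Submodule 𝕜 (Lp 𝕜 p μ) where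
  carrier := {f | ∃ P : Y → 𝕜, f =ᵐ[μ] fun z => P (q z) * g z}
  zero_mem' := ⟨0, (Lp.coeFn_zero 𝕜 p μ).trans (ae_of_all _ fun _ => (zero_mul _).symm)⟩
  add_mem' := by
    rintro f f' ⟨P, hP⟩ ⟨P', hP'⟩
    refine ⟨P + P', ?_⟩
    filter_upwards [hP, hP', Lp.coeFn_add f f'] with z hz hz' hadd
    rw [hadd, Pi.add_apply, hz, hz', Pi.add_apply, add_mul]
  smul_mem' := by
    rintro c f ⟨P, hP⟩
    refine ⟨c • P, ?_⟩
    filter_upwards [hP, Lp.coeFn_smul c f] with z hz hsmul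
    rw [hsmul, Pi.smul_apply, hz, Pi.smul_apply, smul_mul_assoc]

variable {p μ} {q : X → Y} {g : X → 𝕜}

theorem mem_fiberMultiples_of_ae_eq_mul {f f' : Lp 𝕜 p μ} (hf : f ∈ fiberMultiples p μ q g)
    (c : Y → 𝕜) (hf' : f' =ᵐ[μ] fun z => c (q z) * f z) : f' ∈ fiberMultiples p μ q g := by
  obtain ⟨P, hP⟩ := hf
  refine ⟨c * P, ?_⟩
  filter_upwards [hf', hP] with z hz' hz
  rw [hz', hz, Pi.mul_apply, mul_assoc]

theorem isClosed_fiberMultiples [Fact (1 ≤ p)] :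
    IsClosed (fiberMultiples p μ q g : Set (Lp 𝕜 p μ)) := by
  refine IsSeqClosed.isClosed fun f f' hf hlim => ?_
  choose P hP using hf
  obtain ⟨φ, -, hφ⟩ := (tendstoInMeasure_of_tendsto_Lp hlim).exists_seq_tendsto_ae
  -- Where `g z = 0` the limit may fail to exist, but both sides vanish.
  refine ⟨fun y => limUnder atTop fun l => P (φ l) y, ?_⟩
  filter_upwards [hφ, ae_all_iff.2 hP] with z hz hPz
  simp only [hPz] at hz
  by_cases hg : g z = 0
  · simp only [hg, mul_zero] at hz ⊢
    exact tendsto_nhds_unique hz tendsto_const_nhds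
  · have quotient_tendsto := hz.div_const (g z)
    simp only [mul_div_cancel_right₀ _ hg] at quotient_tendsto
    rw [quotient_tendsto.limUnder_eq, div_mul_cancel₀ _ hg]

end FiberMultiples

section CyclicSpaces

variable {H : Type*} [NormedAddCommGroup H] [InnerProductSpace ℂ H] {U : H ≃ₗᵢ[ℂ] H} {x : H}

theorem cyclicSpace_le {S : Submodule ℂ H} (hS : IsClosed (S : Set H)) (hx : x ∈ S)
    (hU : ∀ y ∈ S, U y ∈ S) (hUsymm : ∀ y ∈ S, U.symm y ∈ S) : cyclicSpace U x ≤ S := by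
  refine Submodule.topologicalClosure_minimal _ (Submodule.span_le.2 ?_) hS
  rintro _ ⟨j, rfl⟩
  change (U ^ j) x ∈ S
  induction j using Int.induction_on with
  | zero => exact hx
  | succ j ih =>
    rw [add_comm, zpow_one_add]
    exact hU _ ih
  | pred j ih =>
    rw [sub_eq_neg_add, zpow_add, zpow_neg_one]
    exact hUsymm _ ih

theorem cyclicSpace_zero_le (S : Submodule ℂ H) (hS : IsClosed (S : Set H)) :
    cyclicSpace U 0 ≤ S := by
  refine Submodule.topologicalClosure_minimal _ (Submodule.span_le.2 ?_) hS
  rintro _ ⟨j, rfl⟩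
  simp

theorem IsSpectralMeasure.eq_zero (h : IsSpectralMeasure U x 0) : x = 0 := by
  simpa using h.fourier 0

theorem eq_zero_of_multiplicity_eq_one {μ : ℕ → Measure Circle} [∀ i, IsFiniteMeasure (μ i)]
    (hchain : ∀ i, μ (i + 1) ≪ μ i) (hmult : ∀ᵐ z ∂μ 0, multiplicity μ z = 1) {i : ℕ}
    (hi : i ≠ 0) : μ i = 0 := by
  have hac : μ i ≪ μ 0 := by
    clear hi
    induction i with
    | zero => exact Measure.AbsolutelyContinuous.rfl
    | succ i ih => exact (hchain i).trans ih
  have density_zero : (μ i).rnDeriv (μ 0) =ᵐ[μ 0] 0 := by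
    filter_upwards [hmult, Measure.rnDeriv_self (μ 0)] with z hz hself
    by_contra hne
    have mem_zero : (μ 0).rnDeriv (μ 0) z ≠ 0 := by simp [hself]
    exact hi ((encard_le_one_iff.1 hz.le) i 0 hne mem_zero)
  rw [← Measure.withDensity_rnDeriv_eq _ _ hac, withDensity_congr_ae density_zero, withDensity_zero]

theorem HasSimpleSpectrum.exists_cyclicSpace_eq_top (h : HasSimpleSpectrum U) :
    ∃ x, cyclicSpace U x = ⊤ := by
  obtain ⟨x, μ, hd, hmult⟩ := h
  have (i : ℕ) : IsFiniteMeasure (μ i) := (hd.spectral i).finite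
  have generator_zero (i : ℕ) (hi : i ≠ 0) : x i = 0 :=
    IsSpectralMeasure.eq_zero
      (eq_zero_of_multiplicity_eq_one hd.chain (by simpa using hmult) hi ▸ hd.spectral i)
  refine ⟨x 0, top_unique (hd.total ▸ ?_)⟩
  refine Submodule.topologicalClosure_minimal _ (iSup_le fun i => ?_)
    (Submodule.isClosed_topologicalClosure _)
  rcases eq_or_ne i 0 with rfl | hi
  · exact le_rfl
  · rw [generator_zero i hi]
    exact cyclicSpace_zero_le _ (Submodule.isClosed_topologicalClosure _)

end CyclicSpaces

section PolynomialRoots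

theorem exists_perm_of_map_univ_eq {α β : Type*} [Fintype α] {z w : α → β}
    (h : Finset.univ.val.map z = Finset.univ.val.map w) : ∃ ρ : Perm α, w = z ∘ ρ := by
  classical
  have card_fiber (a : β) : Fintype.card {i // w i = a} = Fintype.card {i // z i = a} := by
    have := congrArg (Multiset.count a) h
    simp only [Multiset.count_map] at this
    simp only [Fintype.card_subtype, eq_comm (b := a)]
    exact this.symm
  exact ⟨ofFiberEquiv fun a => Fintype.equivOfCardEq (card_fiber a),
    funext fun i => (ofFiberEquiv_map _ i).symm⟩

open Polynomial in
theorem exists_perm_of_prod_natCast_sub_eq {R α : Type*} [CommRing R] [IsDomain R] [CharZero R]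
    [Fintype α] {z w : α → R} (h : ∀ c : ℕ, ∏ i, ((c : R) - z i) = ∏ i, ((c : R) - w i)) :
    ∃ ρ : Perm α, w = z ∘ ρ := by
  have polynomial_eq : ∏ i, (X - C (z i)) = ∏ i, (X - C (w i)) := by
    refine eq_of_infinite_eval_eq _ _
      ((infinite_range_of_injective (Nat.cast_injective (R := R))).mono ?_)
    rintro _ ⟨c, rfl⟩
    simpa [eval_prod] using h c
  have roots_prod (u : α → R) : (∏ i, (X - C (u i))).roots = Finset.univ.val.map u := by
    rw [← roots_multiset_prod_X_sub_C (Finset.univ.val.map u), Multiset.map_map]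
    rfl
  exact exists_perm_of_map_univ_eq (by rw [← roots_prod, ← roots_prod, polynomial_eq])

end PolynomialRoots

section Circle

instance instSecondCountableTopologyCircle : SecondCountableTopology Circle :=
  inferInstanceAs (SecondCountableTopology (Metric.sphere (0 : ℂ) 1))

theorem coe_prod_circle {α : Type*} [Fintype α] (z : α → Circle) :
    ((∏ i, z i : Circle) : ℂ) = ∏ i, (z i : ℂ) :=
  map_prod Circle.coeHom z Finset.univ

theorem determinedByProd_of_prod_natCast_sub_eq {α : Type*} [Fintype α] (P : ℕ → Circle → ℂ)
    (g : (α → Circle) → ℂ) :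
    DeterminedByProd {z : α → Circle | ∀ c : ℕ, ∏ i, ((c : ℂ) - z i) = P c (∏ i, z i) * g z} := by
  intro z hz w hw hzw
  -- At `c = 0` the left-hand side depends only on the product of the coordinates.
  have at_zero (u : α → Circle) :
      ∏ i, (((0 : ℕ) : ℂ) - u i) = (-1) ^ Fintype.card α * (∏ i, u i : Circle) := by
    simp [Finset.prod_neg, coe_prod_circle]
  have multiplier_eq : P 0 (∏ i, z i) * g z = P 0 (∏ i, z i) * g w := by
    rw [← hz 0, hzw, ← hw 0, at_zero, at_zero, hzw]
  have multiplier_ne_zero : P 0 (∏ i, z i) ≠ 0 := by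
    refine left_ne_zero_of_mul (b := g z) ?_
    rw [← hz 0, at_zero]
    exact mul_ne_zero (pow_ne_zero _ (neg_ne_zero.2 one_ne_zero)) (Circle.coe_ne_zero _)
  have hg : g z = g w := mul_left_cancel₀ multiplier_ne_zero multiplier_eq
  obtain ⟨ρ, hρ⟩ := exists_perm_of_prod_natCast_sub_eq (z := fun i => (z i : ℂ))
    (w := fun i => (w i : ℂ)) fun c => by rw [hz, hw, hg, hzw]
  exact ⟨ρ, funext fun i => Circle.ext (congrFun hρ i)⟩

variable (σ : Measure Circle) (N : ℕ)

theorem memLp_top_prod_coe :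
    MemLp (fun z : Fin N → Circle => ((∏ i, z i : Circle) : ℂ)) ⊤ (Measure.pi fun _ => σ) :=
  memLp_top_of_bound (Continuous.aestronglyMeasurable (by fun_prop)) 1
    (ae_of_all _ fun _ => (Circle.norm_coe _).le)

/-- Multiplication by `z₁ ⋯ z_N` on `L²(𝕋ᴺ)`. -/
def mulProd : Lp ℂ 2 (Measure.pi fun _ : Fin N => σ) →L[ℂ]
    Lp ℂ 2 (Measure.pi fun _ : Fin N => σ) :=
  (ContinuousLinearMap.mul ℂ ℂ).holderL _ ⊤ 2 2 ((memLp_top_prod_coe σ N).toLp _)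

theorem coeFn_mulProd (f : Lp ℂ 2 (Measure.pi fun _ : Fin N => σ)) :
    mulProd σ N f =ᵐ[Measure.pi fun _ => σ] fun z => (∏ i, z i : Circle) * f z := by
  filter_upwards [(ContinuousLinearMap.mul ℂ ℂ).coeFn_holder (r := 2)
    ((memLp_top_prod_coe σ N).toLp _) f, MemLp.coeFn_toLp (memLp_top_prod_coe σ N)]
    with z hmul hcoe
  refine Eq.trans hmul ?_
  rw [hcoe, ContinuousLinearMap.mul_apply']

variable [IsFiniteMeasure σ]

/-- The identification of a tensor power of `L²(𝕋, σ)` with a space of functions of several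
variables, `f₁ ⊗ ⋯ ⊗ f_N ↦ (z ↦ ∏ i, f i (z i))`. -/
def tensorLp : HilbertTensor N (Lp ℂ 2 σ) →L[ℂ] Lp ℂ 2 (Measure.pi fun _ : Fin N => σ) :=
  hilbertLift prodLp inner_prodLp

theorem tensorLp_tmul (f : Fin N → Lp ℂ 2 σ) :
    tensorLp σ N (AlgTensor.tmul f : AlgTensor N (Lp ℂ 2 σ)) = prodLp f :=
  hilbertLift_tmul _ _ f

theorem prodLp_V (f : Fin N → Lp ℂ 2 σ) :
    prodLp (fun i => V σ (f i)) = mulProd σ N (prodLp f) := by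
  apply Lp.ext
  filter_upwards [coeFn_prodLp fun i => V σ (f i), coeFn_prodLp f, coeFn_mulProd σ N (prodLp f),
    ae_pi_forall_eval fun i => V_apply σ (f i)] with z hVf hf hmul hV
  simp only [hVf, hmul, hf, hV, Finset.prod_mul_distrib, coe_prod_circle]

theorem tensorLp_tensorPow (t : HilbertTensor N (Lp ℂ 2 σ)) :
    tensorLp σ N (tensorPow (V σ) N t) = mulProd σ N (tensorLp σ N t) := by
  have intertwine : (tensorLp σ N).comp (tensorPow (V σ) N : _ →L[ℂ] _) =
      (mulProd σ N).comp (tensorLp σ N) := hilbertTensor_hom_ext fun f => by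
    simp [tensorPow_tmul, tensorLp_tmul, prodLp_V]
  exact DFunLike.congr_fun intertwine t

theorem coeFn_tensorLp_symPow (y : symTensor N (Lp ℂ 2 σ)) :
    tensorLp σ N (symPow (V σ) N y : symTensor N (Lp ℂ 2 σ)) =ᵐ[Measure.pi fun _ => σ]
      fun z => (∏ i, z i : Circle) * tensorLp σ N y z := by
  have : tensorLp σ N (symPow (V σ) N y : symTensor N (Lp ℂ 2 σ)) = mulProd σ N (tensorLp σ N y) :=
    tensorLp_tensorPow σ N y
  rw [this]
  exact coeFn_mulProd σ N _

theorem tensorLp_mem_fiberMultiples {x y : symTensor N (Lp ℂ 2 σ)}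
    (hy : y ∈ cyclicSpace (symPow (V σ) N) x) :
    tensorLp σ N y ∈ fiberMultiples 2 _ (fun z => ∏ i, z i) (tensorLp σ N x) := by
  let toFunction : symTensor N (Lp ℂ 2 σ) →L[ℂ] Lp ℂ 2 (Measure.pi fun _ : Fin N => σ) :=
    (tensorLp σ N).comp (symTensor N _).subtypeL
  let S := (fiberMultiples 2 _ (fun z => ∏ i, z i) (tensorLp σ N x)).comap toFunction.toLinearMap
  refine cyclicSpace_le (S := S) (isClosed_fiberMultiples.preimage toFunction.continuous) ?_
    (fun y hy => ?_) (fun y hy => ?_) hy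
  · exact ⟨1, ae_of_all _ fun _ => (one_mul _).symm⟩
  · exact mem_fiberMultiples_of_ae_eq_mul hy _ (coeFn_tensorLp_symPow σ N y)
  · refine mem_fiberMultiples_of_ae_eq_mul hy (fun p => (p : ℂ)⁻¹) ?_
    filter_upwards [coeFn_tensorLp_symPow σ N ((symPow (V σ) N).symm y)] with z hz
    rw [LinearIsometryEquiv.apply_symm_apply] at hz
    exact ((inv_mul_eq_iff_eq_mul₀ (Circle.coe_ne_zero _)).2 hz).symm

/-- The function `z ↦ c - z` in `L²(𝕋, σ)`. -/
def constSubLp (c : ℂ) : Lp ℂ 2 σ :=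
  ContinuousMap.toLp (E := ℂ) 2 σ ℂ ⟨fun z : Circle => c - z, by fun_prop⟩

theorem coeFn_tensorLp_constSubLp (c : ℂ) :
    tensorLp σ N (AlgTensor.tmul fun _ => constSubLp σ c : AlgTensor N (Lp ℂ 2 σ))
      =ᵐ[Measure.pi fun _ => σ] fun z => ∏ i, (c - z i) := by
  rw [tensorLp_tmul]
  filter_upwards [coeFn_prodLp fun _ : Fin N => constSubLp σ c,
    ae_pi_forall_eval fun _ : Fin N => ContinuousMap.coeFn_toLp (p := 2) (𝕜 := ℂ) σ
      ⟨fun z : Circle => c - z, by fun_prop⟩] with z hprod hconstSub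
  exact hprod.trans (Finset.prod_congr rfl fun i _ => hconstSub i)

theorem HasSimpleSpectrum.exists_determinedByProd (h : HasSimpleSpectrum (symPow (V σ) N)) :
    ∃ A : Set (Fin N → Circle), DeterminedByProd A ∧ ∀ᵐ z ∂Measure.pi fun _ => σ, z ∈ A := by
  obtain ⟨x, hx⟩ := h.exists_cyclicSpace_eq_top
  have multiple (c : ℕ) : ∃ P : Circle → ℂ, ∀ᵐ z ∂Measure.pi fun _ : Fin N => σ,
      ∏ i, ((c : ℂ) - z i) = P (∏ i, z i) * tensorLp σ N x z := by
    obtain ⟨P, hP⟩ := tensorLp_mem_fiberMultiples σ N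
      (hx ▸ Submodule.mem_top :
        ⟨_, tmul_const_mem_symTensor (constSubLp σ c)⟩ ∈ cyclicSpace (symPow (V σ) N) x)
    exact ⟨P, (coeFn_tensorLp_constSubLp σ N c).symm.trans hP⟩
  choose P hP using multiple
  exact ⟨_, determinedByProd_of_prod_natCast_sub_eq P (tensorLp σ N x), ae_all_iff.2 hP⟩

end Circle

end ConvSing

end

theorem mainTheorem4_general (σ : MeasureTheory.Measure Circle) [MeasureTheory.IsFiniteMeasure σ]
    (m k : ℕ) (hsimple : ConvSing.HasSimpleSpectrum (ConvSing.symPow (ConvSing.V σ) (m * k)))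
    (n : ℕ)
    (hn : ((m * k).factorial : ℝ) / (k.factorial : ℝ) ^ m < (m.factorial : ℝ) ^ n) :
    ConvSing.CS n (ConvSing.convPow σ k) := by
  intro ν hfin hatom
  obtain ⟨A, hA, hσA⟩ := hsimple.exists_determinedByProd
  refine ConvSing.mutuallySingular_prodLaw_of_determinedByProd finProdFinEquiv σ hA hσA ν ?_
  rw [div_lt_iff₀ (by positivity)] at hn
  simp only [Fintype.card_fin]
  exact_mod_cast hn

theorem mainTheorem4 (σ : MeasureTheory.Measure Circle) [MeasureTheory.IsFiniteMeasure σ]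
    [MeasureTheory.NullSingletonClass σ] (m k : ℕ) (hm : 1 ≤ m) (hk : 1 ≤ k)
    (hsimple : ConvSing.HasSimpleSpectrum (ConvSing.symPow (ConvSing.V σ) (m * k)))
    (n : ℕ)
    (hn : ((m * k).factorial : ℝ) / (k.factorial : ℝ) ^ m < (m.factorial : ℝ) ^ n) :
    ConvSing.CS n (ConvSing.convPow σ k) :=
  mainTheorem4_general σ m k hsimple n hn
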